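/- Let $K\ge 2$, $B>0$, $\delta\in(0,1)$, and let $\mathcal F$ be the set of probability distributions on $\mathbb R$ with support in $[0,B]$. Write $m(G)$ for the mean of $G$, and for $u\in[0,B]$ put $$\mathcal K_{\inf}^{+}(F,u)=\inf\{\mathrm{KL}(F,G): G\in\mathcal F,\ m(G)>u\},\qquad \mathcal K_{\inf}^{-}(F,u)=\inf\{\mathrm{KL}(F,G): G\in\mathcal F,\ m(G)<u\}$$ (with $\inf\emptyset=+\infty$). Let $\boldsymbol F=(F_1,\dots,F_K)\in\mathcal F^K$ and let $i^\star(\boldsymbol F)=\operatorname{argmax}_k m(F_k)$ be the set of best arms. An arbitrary, possibly randomized, sampling rule chooses in each round $t\ge1$ an arm $I_t\in\{1,\dots,K\}$ that is measurable with respect to the information available before that round (past arms, past rewards and internal randomization), and then observes a reward $X_t$ whose conditional law, given this information, is $F_{I_t}$. Let $N_{n,i}$ be the number of rounds $t\le n$ with $I_t=i$, let $F_{n,i}=\frac1{N_{n,i}}\sum_{t\le n,\,I_t=i}\delta_{X_t}$ be the empirical distribution of arm $i$, and let $$W_n(i,j)=\inf_{x\in[0,B]}\bigl[N_{n,i}\,\mathcal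 K_{\inf}^{-}(F_{n,i},x)+N_{n,j}\,\mathcal K_{\inf}^{+}(F_{n,j},x)\bigr],$$ where the term of an arm with no pulls is $0$. Let $\hat\imath_n\in\operatorname{argmax}_i m(F_{n,i})$, with arbitrary tie-breaking (and $\hat\imath_n$ arbitrary as long as some arm has not been pulled), and $$\tau_\delta=\inf\Bigl\{n\in\mathbb N:\ \min_{j\ne\hat\imath_n}W_n(\hat\imath_n,j)>c(n,\delta)\Bigr\},\qquad c(n,\delta)=\ln(1/\delta)+2\ln(1+n/2)+2+\ln(K-1).$$ Then this stopping rule is $\delta$-correct on $\mathcal F^K$ under any sampling rule: for all $\boldsymbol F\in\mathcal F^K$, $$\mathbb P_{\boldsymbol F}\bigl(\tau_\delta<+\infty,\ \hat\imath_{\tau_\delta}\notin i^\star(\boldsymbol F)\bigr)\le\delta .$$ -/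

import Mathlib

open MeasureTheory ProbabilityTheory InformationTheory
open scoped ENNReal

namespace Bandit

noncomputable section

/-- The probability distributions on `ℝ` whose support is contained in `[0, B]`. -/
def boundedClass (B : ℝ) : Set (Measure ℝ) :=
  {G | IsProbabilityMeasure G ∧ G (Set.Icc 0 B)ᶜ = 0}

/-- The mean `m(G)` of a distribution `G`. -/
def mean (G : Measure ℝ) : ℝ := ∫ x, x ∂G

/-- The set `{m(G) : G ∈ 𝓕}` of possible means of a class `𝓕`. -/
def meanSet (𝓕 : Set (Measure ℝ)) : Set ℝ := mean '' 𝓕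

/-- `K_inf⁺(F, u) = inf {KL(F, G) : G ∈ 𝓕, m(G) > u}`, with `inf ∅ = ∞`. -/
def kinfPlus (𝓕 : Set (Measure ℝ)) (F : Measure ℝ) (u : ℝ) : ℝ≥0∞ :=
  ⨅ G ∈ {G ∈ 𝓕 | u < mean G}, klDiv F G

/-- `K_inf⁻(F, u) = inf {KL(F, G) : G ∈ 𝓕, m(G) < u}`, with `inf ∅ = ∞`. -/
def kinfMinus (𝓕 : Set (Measure ℝ)) (F : Measure ℝ) (u : ℝ) : ℝ≥0∞ :=
  ⨅ G ∈ {G ∈ 𝓕 | mean G < u}, klDiv F G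

/-- The set of the arms with maximal mean. -/
def bestArms {K : ℕ} (F : Fin K → Measure ℝ) : Set (Fin K) :=
  {k | ∀ j, mean (F j) ≤ mean (F k)}

/-- The interaction of an arbitrary (possibly randomized) sampling rule with the arms `F`.
In round `t + 1` the arm `I t` is chosen using the information `ℱ t` available after `t` rounds
(past arms, past rewards, internal randomization), and then the reward `X t` is observed, whose
conditional law given `ℱ t` is that of the chosen arm. -/
structure IsInteraction {Ω : Type*} [mΩ : MeasurableSpace Ω] {K : ℕ} (F : Fin K → Measure ℝ)
    (P : Measure Ω) (ℱ : Filtration ℕ mΩ) (I : ℕ → Ω → Fin K) (X : ℕ → Ω → ℝ) : Prop where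
  measurable_arm : ∀ t, Measurable[ℱ t] (I t)
  measurable_reward : ∀ t, Measurable[ℱ (t + 1)] (X t)
  reward_law : ∀ t, ∀ s : Set ℝ, MeasurableSet s →
    P⟦X t ⁻¹' s | ℱ t⟧ =ᵐ[P] fun ω => (F (I t ω)).real s

section Empirical

variable {Ω : Type*} {K : ℕ} (I : ℕ → Ω → Fin K) (X : ℕ → Ω → ℝ)

/-- `N_{n,i}`: the number of pulls of arm `i` during the first `n` rounds. -/
def pulls (n : ℕ) (i : Fin K) (ω : Ω) : ℕ :=
  ((Finset.range n).filter fun t => I t ω = i).card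

/-- `F_{n,i}`: the empirical distribution of the rewards collected from arm `i` during the first
`n` rounds (the zero measure if arm `i` has not been pulled yet). -/
def empDist (n : ℕ) (i : Fin K) (ω : Ω) : Measure ℝ :=
  (pulls I n i ω : ℝ≥0∞)⁻¹ •
    ∑ t ∈ (Finset.range n).filter (fun t => I t ω = i), Measure.dirac (X t ω)

/-- The empirical transportation cost
`W_n(i, j) = inf_x [N_{n,i} K_inf⁻(F_{n,i}, x) + N_{n,j} K_inf⁺(F_{n,j}, x)]`, where `x` ranges
over the possible means; the term of an arm without pulls is `0`. -/
def transportCost (𝓕 : Set (Measure ℝ)) (n : ℕ) (i j : Fin K) (ω : Ω) : ℝ≥0∞ :=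
  ⨅ x ∈ meanSet 𝓕,
    ((pulls I n i ω : ℝ≥0∞) * kinfMinus 𝓕 (empDist I X n i ω) x
      + (pulls I n j ω : ℝ≥0∞) * kinfPlus 𝓕 (empDist I X n j ω) x)

/-- `ihat` is a version of the recommendation rule `argmax_i μ_{n,i}`, with arbitrary
tie-breaking. Nothing is required as long as some empirical mean is undefined. -/
def IsEmpiricalBest (ihat : ℕ → Ω → Fin K) : Prop :=
  ∀ n ω, (∀ i, 0 < pulls I n i ω) → ihat n ω ∈ bestArms fun i => empDist I X n i ω

/-- The stopping time `inf {n : min_{j ≠ ihat_n} W_n(ihat_n, j) > c(n)}`, equal to `⊤` if there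
is no such `n`, for a nonnegative threshold `c`. -/
def stoppingTime (𝓕 : Set (Measure ℝ)) (ihat : ℕ → Ω → Fin K) (c : ℕ → ℝ) (ω : Ω) : ℕ∞ :=
  ⨅ n ∈ {n : ℕ | ENNReal.ofReal (c n) <
    ⨅ (j : Fin K) (_ : j ≠ ihat n ω), transportCost I X 𝓕 n (ihat n ω) j ω}, (n : ℕ∞)

end Empirical

/-- The threshold `c(n, δ) = ln(1/δ) + 2 ln(1 + n/2) + 2 + ln(K - 1)`. -/
def threshold (K : ℕ) (δ : ℝ) (n : ℕ) : ℝ :=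
  Real.log (1 / δ) + 2 * Real.log (1 + (n : ℝ) / 2) + 2 + Real.log ((K : ℝ) - 1)

end

end Bandit

/-! The error event forces some suboptimal arm `i` to look better than a fixed best arm `j`. For such
a pair, fix a level `x` between the two means and bet, in each round, on the reward of the pulled
arm: on a mean of `i` above its true value, on a mean of `j` below its true value. The bet with
fraction `θ` multiplies the wealth by `1 - θ + θ r`, where the payoff `r` is affine in the reward,
nonnegative on `[0, B]`, and of expectation at most `1` under the true arm. Hence the wealth is a
nonnegative supermartingale under any sampling rule, and so is its mixture over independent uniform
fractions for the two arms; Ville's inequality (`Bandit.IsInteraction.measure_mixture_ge_le`) bounds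
the probability that it ever reaches `(K - 1) / δ`.

Two deterministic facts tie the wealth to the transportation cost. By the duality for `K_inf`
(`exists_klDiv_empirical_eq`), `N K_inf` of an empirical distribution is at most the logarithm of the
wealth of the best constant fraction in hindsight. By the universal portfolio bound
(`prod_betFactor_le_lintegral`), that wealth exceeds the one of the uniform mixture by a factor
`exp 1 * (N + 1)` at most. The two factors multiply to at most `(exp 1 * (1 + n / 2)) ^ 2`, which is
what the threshold pays for. A union bound over the at most `K - 1` suboptimal arms concludes. -/

open Bandit

/-! ### Betting on a mean, and the dual of `K_inf` -/

/-- The growth factor of a bettor who puts a fraction `θ` of the wealth on a bet with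
payoff `r`. -/
def betFactor (θ r : ℝ) : ℝ := 1 - θ + θ * r

/-- The affine payoff `(e - x) / (e - b)`, equal to `1` at `b` and to `0` at the endpoint `e` of
`[0, B]`. For `0 < b < B` it is nonnegative on `[0, B]`, and its expectation is at most `1` iff the
mean is at least `b` (when `e = B`), respectively at most `b` (when `e = 0`). -/
noncomputable def meanBet (e b x : ℝ) : ℝ := (e - x) / (e - b)

lemma betFactor_nonneg {θ r : ℝ} (hθ : θ ∈ Set.Icc (0 : ℝ) 1) (hr : 0 ≤ r) :
    0 ≤ betFactor θ r := by
  have := mul_nonneg hθ.1 hr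
  unfold betFactor; linarith [hθ.2]

/-- The first-order conditions for the best constant betting fraction in hindsight. At `θ = 0` and
`θ = 1` the derivative of the wealth may be nonzero, hence the two inequalities. -/
lemma exists_optimal_fraction {ι : Type*} (T : Finset ι) (r : ι → ℝ) (hr : ∀ t ∈ T, 0 ≤ r t) :
    ∃ θ ∈ Set.Icc (0 : ℝ) 1, (∀ t ∈ T, 0 < betFactor θ (r t)) ∧
      1 ≤ ∏ t ∈ T, betFactor θ (r t) ∧
      (∑ t ∈ T, (r t - 1) / betFactor θ (r t)) * (1 - θ) ≤ 0 ∧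
      0 ≤ θ * ∑ t ∈ T, (r t - 1) / betFactor θ (r t) := by
  classical
  have hc : Continuous fun θ : ℝ => ∏ t ∈ T, betFactor θ (r t) := by
    unfold betFactor; fun_prop
  obtain ⟨θ, hθ, hmax⟩ := isCompact_Icc.exists_isMaxOn (s := Set.Icc (0 : ℝ) 1) ⟨0, by simp⟩
    hc.continuousOn
  have h1 : 1 ≤ ∏ t ∈ T, betFactor θ (r t) := by
    have := hmax (show (0 : ℝ) ∈ Set.Icc (0 : ℝ) 1 by simp)
    simpa [betFactor] using this
  have hpos : ∀ t ∈ T, 0 < betFactor θ (r t) := fun t ht =>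
    lt_of_le_of_ne (betFactor_nonneg hθ (hr t ht)) fun h => by
      rw [Finset.prod_eq_zero ht h.symm] at h1
      linarith
  have hd : HasDerivAt (fun θ : ℝ => ∏ t ∈ T, betFactor θ (r t))
      ((∏ t ∈ T, betFactor θ (r t)) * ∑ t ∈ T, (r t - 1) / betFactor θ (r t)) θ := by
    have h := HasDerivAt.fun_finsetProd (u := T) (f := fun t θ => betFactor θ (r t))
      (f' := fun t => r t - 1) (x := θ) fun t _ => by
        exact (((hasDerivAt_id θ).const_sub 1).add
          ((hasDerivAt_id θ).mul_const (r t))).congr_deriv (by ring)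
    refine h.congr_deriv ?_
    rw [Finset.mul_sum]
    refine Finset.sum_congr rfl fun t ht => ?_
    rw [← Finset.mul_prod_erase T _ ht, smul_eq_mul]
    field_simp [(hpos t ht).ne']
  have key : ∀ y ∈ Set.Icc (0 : ℝ) 1,
      (∑ t ∈ T, (r t - 1) / betFactor θ (r t)) * (y - θ) ≤ 0 := by
    intro y hy
    have h := IsLocalMaxOn.hasFDerivWithinAt_nonpos hmax.localize
      hd.hasFDerivAt.hasFDerivWithinAt
      (sub_mem_posTangentConeAt_of_segment_subset ((convex_Icc (0 : ℝ) 1).segment_subset hθ hy))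
    simp only [ContinuousLinearMap.toSpanSingleton_apply, smul_eq_mul] at h
    by_contra! h'
    have := mul_pos (zero_lt_one.trans_le h1) h'
    linarith
  refine ⟨θ, hθ, hpos, h1, key 1 (by simp), ?_⟩
  have := key 0 (by simp)
  linarith

/-- Upper bound for `K_inf` of an empirical distribution by the dual problem: with `θ` the best
betting fraction in hindsight, reweighting the sample points by the inverse growth factors, and
adding the missing mass as an atom at `e`, gives a distribution `G` that satisfies the mean
constraint and whose likelihood ratio is the growth factor. -/
lemma exists_klDiv_empirical_eq {ι : Type*} {T : Finset ι} (hT : T.Nonempty) {x : ι → ℝ}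
    {B e b : ℝ} (he : e ∈ Set.Icc 0 B) (hx : ∀ t ∈ T, x t ∈ Set.Icc 0 B)
    (hr : ∀ t ∈ T, 0 ≤ meanBet e b (x t)) :
    ∃ θ ∈ Set.Icc (0 : ℝ) 1, 1 ≤ ∏ t ∈ T, betFactor θ (meanBet e b (x t)) ∧
      ∃ G ∈ boundedClass B, meanBet e b (mean G) ≤ 1 ∧
        (T.card : ℝ≥0∞) *
          klDiv ((T.card : ℝ≥0∞)⁻¹ • ∑ t ∈ T, Measure.dirac (x t)) G =
        ENNReal.ofReal (Real.log (∏ t ∈ T, betFactor θ (meanBet e b (x t)))) := by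
  obtain ⟨θ, hθ, hpos, h1, hs1, hs0⟩ := exists_optimal_fraction T (fun t => meanBet e b (x t)) hr
  refine ⟨θ, hθ, h1, ?_⟩
  set f : ℝ → ℝ := fun y => betFactor θ (meanBet e b y) with hf
  set s : ℝ := ∑ t ∈ T, (meanBet e b (x t) - 1) / betFactor θ (meanBet e b (x t)) with hs
  have hn : (0 : ℝ) < T.card := by exact_mod_cast hT.card_pos
  have hn0 : (T.card : ℝ≥0∞) ≠ 0 := by exact_mod_cast hT.card_pos.ne'
  have hnt : (T.card : ℝ≥0∞) ≠ ∞ := ENNReal.natCast_ne_top _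
  have hfm : Measurable f := by
    simp only [hf, betFactor, meanBet]; fun_prop
  set F : Measure ℝ := (T.card : ℝ≥0∞)⁻¹ • ∑ t ∈ T, Measure.dirac (x t) with hF
  set G : Measure ℝ := (T.card : ℝ≥0∞)⁻¹ • (∑ t ∈ T, ENNReal.ofReal (f (x t))⁻¹ •
    Measure.dirac (x t) + ENNReal.ofReal (θ * s) • Measure.dirac e) with hG
  have hmass : ∑ t ∈ T, (f (x t))⁻¹ = T.card - θ * s := by
    rw [hs, Finset.mul_sum, Finset.card_eq_sum_ones, Nat.cast_sum, ← Finset.sum_sub_distrib]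
    refine Finset.sum_congr rfl fun t ht => ?_
    have := (hpos t ht).ne'
    simp only [hf]
    field_simp
    simp only [betFactor]; push_cast; ring
  have hGl : ∀ g : ℝ → ℝ≥0∞, ∫⁻ y, g y ∂G = (T.card : ℝ≥0∞)⁻¹ *
      (∑ t ∈ T, ENNReal.ofReal (f (x t))⁻¹ * g (x t) + ENNReal.ofReal (θ * s) * g e) := by
    intro g
    simp [hG, lintegral_smul_measure, lintegral_finsetSum_measure, mul_add]
  have hFl : ∀ g : ℝ → ℝ≥0∞, ∫⁻ y, g y ∂F = (T.card : ℝ≥0∞)⁻¹ * ∑ t ∈ T, g (x t) := by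
    intro g
    simp [hF, lintegral_smul_measure, lintegral_finsetSum_measure]
  have hGprob : IsProbabilityMeasure G := by
    constructor
    rw [← lintegral_one, hGl]
    simp only [mul_one]
    rw [← ENNReal.ofReal_sum_of_nonneg fun t ht => (inv_pos.2 (hpos t ht)).le, hmass,
      ← ENNReal.ofReal_add _ hs0, sub_add_cancel, ENNReal.ofReal_natCast,
      ENNReal.inv_mul_cancel hn0 hnt]
    rw [← hmass]
    exact Finset.sum_nonneg fun t ht => (inv_pos.2 (hpos t ht)).le
  have hFprob : IsProbabilityMeasure F := by
    constructor
    rw [← lintegral_one, hFl]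
    simp [ENNReal.inv_mul_cancel hn0 hnt]
  -- The atom at `e` is invisible for `F`: it is present only if `θ = 1`, and then `f e = 0`.
  have hwe : θ * s * f e = 0 := by
    have h2 : f e = 1 - θ := by simp [hf, betFactor, meanBet]
    rw [h2]
    apply le_antisymm
    · nlinarith [mul_nonneg hθ.1 (neg_nonneg.2 hs1)]
    · exact mul_nonneg hs0 (sub_nonneg.2 hθ.2)
  have hFG : F = G.withDensity fun y => ENNReal.ofReal (f y) := by
    ext A hA
    rw [withDensity_apply _ hA, ← lintegral_indicator hA, hGl, ← lintegral_indicator_one hA, hFl]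
    congr 1
    have h0 : ENNReal.ofReal (θ * s) *
        A.indicator (fun y => ENNReal.ofReal (f y)) e = 0 := by
      by_cases heA : e ∈ A
      · rw [Set.indicator_of_mem heA, ← ENNReal.ofReal_mul hs0, hwe, ENNReal.ofReal_zero]
      · simp [heA]
    rw [h0, add_zero]
    refine Finset.sum_congr rfl fun t ht => ?_
    by_cases htA : x t ∈ A
    · have h3 : f (x t) ≠ 0 := (hpos t ht).ne'
      rw [Set.indicator_of_mem htA, Set.indicator_of_mem htA,
        ← ENNReal.ofReal_mul (inv_pos.2 (hpos t ht)).le]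
      rw [inv_mul_cancel₀ h3, ENNReal.ofReal_one, Pi.one_apply]
    · simp [htA]
  have hac : F ≪ G := hFG ▸ withDensity_absolutelyContinuous _ _
  have hFae : ∀ p : ℝ → Prop, (∀ t ∈ T, p (x t)) → ∀ᵐ y ∂F, p y := by
    intro p hp
    rw [hF]
    refine Measure.ae_smul_measure ?_ _
    rw [ae_iff, Measure.finsetSum_apply]
    refine Finset.sum_eq_zero fun t ht => ?_
    rw [← ae_iff, ae_dirac_eq]
    exact hp t ht
  have hllr : llr F G =ᵐ[F] fun y => Real.log (f y) := by
    have h := Measure.rnDeriv_withDensity G hfm.ennreal_ofReal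
    rw [← hFG] at h
    filter_upwards [hac.ae_le h, hFae (fun y => 0 < f y) hpos] with y hy hy0
    rw [llr, hy, ENNReal.toReal_ofReal hy0.le]
  have hFint : ∀ g : ℝ → ℝ, Integrable g F := fun g => by
    rw [hF]
    exact Integrable.smul_measure (integrable_finsetSum_measure.2 fun t _ =>
      integrable_dirac (by simp)) (ENNReal.inv_ne_top.2 hn0)
  have hkl : klDiv F G = ENNReal.ofReal ((T.card : ℝ)⁻¹ * ∑ t ∈ T, Real.log (f (x t))) := by
    rw [klDiv_of_ac_of_integrable hac ((hFint _).congr hllr.symm), integral_congr_ae hllr]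
    have : ∫ y, Real.log (f y) ∂F = (T.card : ℝ)⁻¹ * ∑ t ∈ T, Real.log (f (x t)) := by
      rw [hF, integral_smul_measure, integral_finsetSum_measure fun t _ =>
        integrable_dirac (by simp)]
      simp
    rw [this]
    simp
  refine ⟨G, ⟨hGprob, ?_⟩, ?_, ?_⟩
  · rw [← lintegral_indicator_one measurableSet_Icc.compl, hGl]
    have : ∑ t ∈ T, ENNReal.ofReal (f (x t))⁻¹ * (Set.Icc 0 B)ᶜ.indicator 1 (x t) = 0 :=
      Finset.sum_eq_zero fun t ht => by simp [(hx t ht).1, (hx t ht).2]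
    rw [this]
    simp [he.1, he.2]
  · have hint : ∀ g : ℝ → ℝ, ∫ y, g y ∂G =
        (T.card : ℝ)⁻¹ * (∑ t ∈ T, (f (x t))⁻¹ * g (x t) + θ * s * g e) := by
      intro g
      have hi1 : ∀ t ∈ T, Integrable g (ENNReal.ofReal (f (x t))⁻¹ • Measure.dirac (x t)) :=
        fun t _ => (integrable_dirac (by simp)).smul_measure ENNReal.ofReal_ne_top
      have hi2 : Integrable g (ENNReal.ofReal (θ * s) • Measure.dirac e) :=
        (integrable_dirac (by simp)).smul_measure ENNReal.ofReal_ne_top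
      rw [hG, integral_smul_measure,
        integral_add_measure (integrable_finsetSum_measure.2 hi1) hi2,
        integral_finsetSum_measure hi1]
      simp only [integral_smul_measure, integral_dirac, smul_eq_mul, ENNReal.toReal_inv,
        ENNReal.toReal_natCast, ENNReal.toReal_ofReal hs0]
      congr 2
      refine Finset.sum_congr rfl fun t ht => ?_
      rw [ENNReal.toReal_ofReal (inv_pos.2 (hpos t ht)).le]
    have hm : meanBet e b (mean G) = (T.card : ℝ)⁻¹ *
        (∑ t ∈ T, (f (x t))⁻¹ * meanBet e b (x t)) := by
      have h5 : ∑ t ∈ T, (f (x t))⁻¹ * meanBet e b (x t) =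
          (e * ∑ t ∈ T, (f (x t))⁻¹ - ∑ t ∈ T, (f (x t))⁻¹ * x t) / (e - b) := by
        rw [Finset.mul_sum, ← Finset.sum_sub_distrib, Finset.sum_div]
        refine Finset.sum_congr rfl fun t ht => ?_
        simp only [meanBet]; ring
      rw [h5, hmass, mean, hint]
      simp only [meanBet]
      rw [← mul_div_assoc]
      congr 1
      field_simp
      ring
    have h6 : ∑ t ∈ T, (f (x t))⁻¹ * meanBet e b (x t) = s + (T.card - θ * s) := by
      rw [← hmass, hs, ← Finset.sum_add_distrib]
      refine Finset.sum_congr rfl fun t ht => ?_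
      simp only [hf]; ring
    rw [hm, h6, inv_mul_le_iff₀ hn]
    linarith
  · rw [hkl, ← ENNReal.ofReal_natCast, ← ENNReal.ofReal_mul hn.le, ← mul_assoc,
      mul_inv_cancel₀ hn.ne', one_mul, Real.log_prod fun t ht => (hpos t ht).ne']

/-! ### The uniform mixture of betting fractions -/

/-- Universal portfolio bound: the fractions in the interval of length `1 / (n + 1)` from
`(1 - 1 / (n + 1)) θ` on lose against `θ` at most the factor `1 - 1 / (n + 1)` per round. -/
lemma prod_betFactor_le_lintegral {ι : Type*} (T : Finset ι) (r : ι → ℝ)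
    (hr : ∀ t ∈ T, 0 ≤ r t) {θ : ℝ} (hθ : θ ∈ Set.Icc (0 : ℝ) 1) :
    ENNReal.ofReal (∏ t ∈ T, betFactor θ (r t)) ≤
      ENNReal.ofReal (Real.exp 1 * (T.card + 1)) *
        ∫⁻ η : unitInterval, ∏ t ∈ T, ENNReal.ofReal (betFactor η (r t)) := by
  set n : ℝ := (T.card : ℝ) with hn
  have hn0 : 0 ≤ n := Nat.cast_nonneg _
  set ε : ℝ := (n + 1)⁻¹ with hε
  have hε0 : 0 < ε := by positivity
  have hε1 : ε ≤ 1 := inv_le_one_of_one_le₀ (by linarith)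
  have ha : (1 - ε) * θ ∈ Set.Icc (0 : ℝ) 1 :=
    ⟨mul_nonneg (by linarith) hθ.1, by nlinarith [hθ.1, hθ.2]⟩
  have hb : (1 - ε) * θ + ε ∈ Set.Icc (0 : ℝ) 1 :=
    ⟨by linarith [ha.1], by nlinarith [hθ.1, hθ.2]⟩
  set P : ℝ := ∏ t ∈ T, betFactor θ (r t) with hP
  have hP0 : 0 ≤ P := Finset.prod_nonneg fun t ht => betFactor_nonneg hθ (hr t ht)
  have hexp : (Real.exp 1)⁻¹ ≤ (1 - ε) ^ T.card := by
    rcases Nat.eq_zero_or_pos T.card with h | h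
    · rw [h, pow_zero]; exact inv_le_one_of_one_le₀ (Real.one_le_exp zero_le_one)
    · have hnp : 0 < n := by rw [hn]; exact_mod_cast h
      have h1 : 1 - ε = (1 + n⁻¹)⁻¹ := by rw [hε]; field_simp; ring
      rw [h1, inv_pow]
      refine inv_anti₀ (by positivity) ?_
      have h2 := pow_le_pow_left₀ (by positivity) (Real.add_one_le_exp n⁻¹) T.card
      rw [← Real.exp_nat_mul, ← hn, mul_inv_cancel₀ hnp.ne'] at h2
      rwa [add_comm]
  have hlow : ∀ η ∈ Set.Icc (⟨(1 - ε) * θ, ha⟩ : unitInterval) ⟨(1 - ε) * θ + ε, hb⟩,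
      ENNReal.ofReal ((Real.exp 1)⁻¹ * P) ≤
        ∏ t ∈ T, ENNReal.ofReal (betFactor η (r t)) := by
    intro η hη
    have hη1 : (1 - ε) * θ ≤ η := hη.1
    have hη2 : (η : ℝ) ≤ (1 - ε) * θ + ε := hη.2
    rw [← ENNReal.ofReal_prod_of_nonneg fun t ht => betFactor_nonneg η.2 (hr t ht)]
    refine ENNReal.ofReal_le_ofReal ?_
    calc (Real.exp 1)⁻¹ * P ≤ (1 - ε) ^ T.card * P := by gcongr
      _ = ∏ t ∈ T, (1 - ε) * betFactor θ (r t) := by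
        rw [Finset.prod_mul_distrib, Finset.prod_const]
      _ ≤ _ := Finset.prod_le_prod
        (fun t ht => mul_nonneg (by linarith) (betFactor_nonneg hθ (hr t ht))) fun t ht => by
          have := mul_le_mul_of_nonneg_right hη1 (hr t ht)
          simp only [betFactor]
          linarith
  have hint : ENNReal.ofReal ((Real.exp 1)⁻¹ * P) * ENNReal.ofReal ε ≤
      ∫⁻ η : unitInterval, ∏ t ∈ T, ENNReal.ofReal (betFactor η (r t)) := by
    calc _ = ∫⁻ _ in Set.Icc (⟨(1 - ε) * θ, ha⟩ : unitInterval) ⟨(1 - ε) * θ + ε, hb⟩,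
          ENNReal.ofReal ((Real.exp 1)⁻¹ * P) := by
          rw [setLIntegral_const, unitInterval.volume_Icc]; simp
      _ ≤ ∫⁻ η in Set.Icc (⟨(1 - ε) * θ, ha⟩ : unitInterval) ⟨(1 - ε) * θ + ε, hb⟩,
          ∏ t ∈ T, ENNReal.ofReal (betFactor η (r t)) :=
          setLIntegral_mono' measurableSet_Icc hlow
      _ ≤ _ := setLIntegral_le_lintegral _ _
  refine le_trans (le_of_eq ?_) (mul_le_mul_right hint _)
  rw [← ENNReal.ofReal_mul (by positivity), ← ENNReal.ofReal_mul (by positivity)]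
  congr 1
  rw [hε]
  have := Real.exp_pos 1
  field_simp

/-! ### Ville's inequality under an arbitrary sampling rule -/

/-- Ville's inequality for a process in `[0, ∞]` with the supermartingale property expressed by
integrals over the events of the past. -/
lemma measure_exists_le_of_setLIntegral_le {Ω : Type*} {mΩ : MeasurableSpace Ω} {P : Measure Ω}
    {ℱ : Filtration ℕ mΩ} {M : ℕ → Ω → ℝ≥0∞} (hM : ∀ n, Measurable[ℱ n] (M n))
    (hsup : ∀ n A, MeasurableSet[ℱ n] A → ∫⁻ ω in A, M (n + 1) ω ∂P ≤ ∫⁻ ω in A, M n ω ∂P)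
    (c : ℝ≥0∞) :
    c * P {ω | ∃ n, c ≤ M n ω} ≤ ∫⁻ ω, M 0 ω ∂P := by
  set S : ℕ → Set Ω := fun N => {ω | ∃ n < N, c ≤ M n ω} with hS
  have hle : ∀ n, MeasurableSet[ℱ n] {ω | c ≤ M n ω} := fun n =>
    measurableSet_le measurable_const (hM n)
  have hSm : ∀ N, MeasurableSet[ℱ N] (S N) := by
    intro N
    have : S N = ⋃ n, ⋃ (_ : n < N), {ω | c ≤ M n ω} := by ext; simp [hS]
    rw [this]
    exact MeasurableSet.iUnion fun n => MeasurableSet.iUnion fun hn => ℱ.mono hn.le _ (hle n)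
  -- The wealth at the first passage above `c`, stopped at time `N`.
  have key : ∀ N, c * P (S N) + ∫⁻ ω in (S N)ᶜ, M N ω ∂P ≤ ∫⁻ ω, M 0 ω ∂P := by
    intro N
    induction N with
    | zero => simp [hS]
    | succ N ih =>
      refine le_trans ?_ ih
      have hD : MeasurableSet[ℱ N] ((S N)ᶜ ∩ {ω | c ≤ M N ω}) := (hSm N).compl.inter (hle N)
      have hE : MeasurableSet[ℱ N] ((S N)ᶜ \ {ω | c ≤ M N ω}) := (hSm N).compl.diff (hle N)
      have hSs : S (N + 1) = S N ∪ ((S N)ᶜ ∩ {ω | c ≤ M N ω}) := by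
        ext ω
        simp only [hS, Set.mem_ofPred_eq, Set.mem_union, Set.mem_inter_iff, Set.mem_compl_iff,
          Nat.lt_succ_iff_lt_or_eq, or_and_right, exists_or, exists_eq_left]
        by_cases h : ∃ n < N, c ≤ M n ω <;> simp [h]
      have hSc : (S (N + 1))ᶜ = (S N)ᶜ \ {ω | c ≤ M N ω} := by
        rw [hSs]; ext ω; simp only [Set.mem_compl_iff, Set.mem_union, Set.mem_inter_iff,
          Set.mem_sdiff]; tauto
      calc c * P (S (N + 1)) + ∫⁻ ω in (S (N + 1))ᶜ, M (N + 1) ω ∂P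
          ≤ c * (P (S N) + P ((S N)ᶜ ∩ {ω | c ≤ M N ω})) +
              ∫⁻ ω in (S N)ᶜ \ {ω | c ≤ M N ω}, M N ω ∂P := by
            rw [hSc]
            refine add_le_add ?_ (hsup N _ hE)
            rw [hSs]
            gcongr
            exact measure_union_le _ _
        _ ≤ c * P (S N) + (∫⁻ ω in (S N)ᶜ ∩ {ω | c ≤ M N ω}, M N ω ∂P +
              ∫⁻ ω in (S N)ᶜ \ {ω | c ≤ M N ω}, M N ω ∂P) := by
            rw [mul_add, add_assoc]
            gcongr
            rw [← setLIntegral_const]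
            exact setLIntegral_mono' (ℱ.le N _ hD) fun ω hω => hω.2
        _ = _ := by rw [lintegral_inter_add_sdiff _ _ (ℱ.le N _ (hle N))]
  have hmono : Monotone S := fun a b hab ω ⟨n, hn, h⟩ => ⟨n, hn.trans_le hab, h⟩
  have hU : {ω | ∃ n, c ≤ M n ω} = ⋃ N, S N := by
    ext ω
    simp only [hS, Set.mem_ofPred_eq, Set.mem_iUnion]
    exact ⟨fun ⟨n, h⟩ => ⟨n + 1, n, n.lt_succ_self, h⟩, fun ⟨_, n, _, h⟩ => ⟨n, h⟩⟩
  rw [hU, hmono.measure_iUnion, ENNReal.mul_iSup]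
  exact iSup_le fun N => le_self_add.trans (key N)

section

variable {Ω : Type*} [mΩ : MeasurableSpace Ω] {K : ℕ} {F : Fin K → Measure ℝ} {P : Measure Ω}
  [IsProbabilityMeasure P] {ℱ : Filtration ℕ mΩ} {I : ℕ → Ω → Fin K} {X : ℕ → Ω → ℝ}

/-- Given the past and the event that arm `k` is chosen, the reward has law `F k`. -/
lemma Bandit.IsInteraction.map_restrict (h : IsInteraction F P ℱ I X)
    [∀ k, IsProbabilityMeasure (F k)] (n : ℕ) (k : Fin K) {A : Set Ω}
    (hA : MeasurableSet[ℱ n] A) :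
    (P.restrict (A ∩ I n ⁻¹' {k})).map (X n) = P (A ∩ I n ⁻¹' {k}) • F k := by
  have hX : Measurable (X n) := (h.measurable_reward n).mono (ℱ.le _) le_rfl
  have hC : MeasurableSet[ℱ n] (A ∩ I n ⁻¹' {k}) :=
    hA.inter (h.measurable_arm n (measurableSet_singleton k))
  ext s hs
  rw [Measure.map_apply hX hs, Measure.smul_apply, smul_eq_mul,
    ← ENNReal.toReal_eq_toReal_iff' (measure_ne_top _ _)
      (ENNReal.mul_ne_top (measure_ne_top _ _) (measure_ne_top _ _))]
  have h1 := setIntegral_condExp (ℱ.le n) (μ := P)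
    (f := (X n ⁻¹' s).indicator fun _ => (1 : ℝ))
    ((integrable_const (1 : ℝ)).indicator (hX hs)) hC
  rw [integral_indicator_const _ (hX hs)] at h1
  have h2 : ∫ ω in A ∩ I n ⁻¹' {k}, (P⟦X n ⁻¹' s | ℱ n⟧) ω ∂P =
      ∫ ω in A ∩ I n ⁻¹' {k}, (F k).real s ∂P := by
    refine setIntegral_congr_ae (ℱ.le n _ hC) ?_
    filter_upwards [h.reward_law n s hs] with ω hω hωC
    have : I n ω = k := hωC.2
    rw [hω, this]
  rw [h2, setIntegral_const] at h1
  simpa [Measure.real, ENNReal.toReal_mul] using h1.symm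

lemma Bandit.IsInteraction.ae_mem (h : IsInteraction F P ℱ I X)
    [∀ k, IsProbabilityMeasure (F k)] {s : Set ℝ} (hs : MeasurableSet s)
    (hF : ∀ k, F k sᶜ = 0) : ∀ᵐ ω ∂P, ∀ n, X n ω ∈ s := by
  rw [ae_all_iff]
  intro n
  have hX : Measurable (X n) := (h.measurable_reward n).mono (ℱ.le _) le_rfl
  have hk : ∀ k, P (X n ⁻¹' sᶜ ∩ I n ⁻¹' {k}) = 0 := by
    intro k
    have h1 := congrArg (fun μ => μ sᶜ) (h.map_restrict n k MeasurableSet.univ)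
    simp only [Measure.smul_apply, hF, smul_zero] at h1
    rw [Measure.map_apply hX hs.compl, Measure.restrict_apply (hX hs.compl), Set.univ_inter] at h1
    exact h1
  refine measure_mono_null (t := ⋃ k, X n ⁻¹' sᶜ ∩ I n ⁻¹' {k}) ?_ (measure_iUnion_null hk)
  intro ω hω
  simp only [Set.mem_iUnion]
  exact ⟨I n ω, hω, rfl⟩

/-- A bet whose payoff has expectation at most `1` under each arm does not increase the expected
wealth, whatever the sampling rule. -/
lemma Bandit.IsInteraction.lintegral_mul_le (h : IsInteraction F P ℱ I X)
    [∀ k, IsProbabilityMeasure (F k)] (n : ℕ) {Y : Ω → ℝ≥0∞} (hY : Measurable[ℱ n] Y)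
    {g : Fin K → ℝ → ℝ≥0∞} (hg : ∀ k, Measurable (g k)) (hg1 : ∀ k, ∫⁻ x, g k x ∂(F k) ≤ 1) :
    ∫⁻ ω, Y ω * g (I n ω) (X n ω) ∂P ≤ ∫⁻ ω, Y ω ∂P := by
  have hX : Measurable (X n) := (h.measurable_reward n).mono (ℱ.le _) le_rfl
  have hI : Measurable (I n) := (h.measurable_arm n).mono (ℱ.le _) le_rfl
  have hgm : Measurable fun ω => g (I n ω) (X n ω) :=
    (measurable_from_prod_countable_right (f := fun p : Fin K × ℝ => g p.1 p.2) hg).comp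
      (hI.prodMk hX)
  have hle : (P.withDensity fun ω => g (I n ω) (X n ω)).trim (ℱ.le n) ≤ P.trim (ℱ.le n) := by
    refine Measure.le_iff.2 fun A hA => ?_
    have hAk : ∀ k, MeasurableSet[ℱ n] (A ∩ I n ⁻¹' {k}) := fun k =>
      hA.inter (h.measurable_arm n (measurableSet_singleton k))
    have hdisj : Pairwise (Function.onFun Disjoint fun k => A ∩ I n ⁻¹' {k}) := by
      intro k l hkl
      refine Set.disjoint_left.2 fun ω h1 h2 => hkl ?_
      exact (h1.2 : I n ω = k).symm.trans h2.2
    have hun : A = ⋃ k, A ∩ I n ⁻¹' {k} := by ext ω; simp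
    rw [trim_measurableSet_eq _ hA, trim_measurableSet_eq _ hA, hun,
      measure_iUnion hdisj fun k => ℱ.le n _ (hAk k),
      measure_iUnion hdisj fun k => ℱ.le n _ (hAk k)]
    refine ENNReal.tsum_le_tsum fun k => ?_
    rw [withDensity_apply _ (ℱ.le n _ (hAk k))]
    calc ∫⁻ ω in A ∩ I n ⁻¹' {k}, g (I n ω) (X n ω) ∂P
        = ∫⁻ ω in A ∩ I n ⁻¹' {k}, g k (X n ω) ∂P := by
          refine setLIntegral_congr_fun (ℱ.le n _ (hAk k)) fun ω hω => ?_
          have : I n ω = k := hω.2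
          simp only [this]
      _ = P (A ∩ I n ⁻¹' {k}) * ∫⁻ x, g k x ∂(F k) := by
          rw [← lintegral_map (hg k) hX, h.map_restrict n k hA, lintegral_smul_measure, smul_eq_mul]
      _ ≤ P (A ∩ I n ⁻¹' {k}) := mul_le_of_le_one_right' (hg1 k)
  calc ∫⁻ ω, Y ω * g (I n ω) (X n ω) ∂P
      = ∫⁻ ω, Y ω ∂((P.withDensity fun ω => g (I n ω) (X n ω)).trim (ℱ.le n)) := by
        rw [lintegral_trim _ hY,
          lintegral_withDensity_eq_lintegral_mul _ hgm (hY.mono (ℱ.le n) le_rfl)]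
        simp [mul_comm]
    _ ≤ ∫⁻ ω, Y ω ∂(P.trim (ℱ.le n)) := lintegral_mono' hle le_rfl
    _ = _ := lintegral_trim _ hY

/-- Ville's inequality for a mixture, with respect to a prior `π`, of betting strategies that have
no advantage over any of the arms. -/
lemma Bandit.IsInteraction.measure_mixture_ge_le (h : IsInteraction F P ℱ I X)
    [∀ k, IsProbabilityMeasure (F k)] {Θ : Type*} [MeasurableSpace Θ] (π : Measure Θ)
    [IsProbabilityMeasure π] {φ : Θ → Fin K → ℝ → ℝ≥0∞}
    (hφ : ∀ k, Measurable fun p : Θ × ℝ => φ p.1 k p.2)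
    (hφ1 : ∀ θ k, ∫⁻ x, φ θ k x ∂(F k) ≤ 1) (c : ℝ≥0∞) :
    c * P {ω | ∃ n, c ≤ ∫⁻ θ, ∏ t ∈ Finset.range n, φ θ (I t ω) (X t ω) ∂π} ≤ 1 := by
  have hφ' : Measurable fun p : Fin K × Θ × ℝ => φ p.2.1 p.1 p.2.2 :=
    measurable_from_prod_countable_right hφ
  have hjoint : ∀ {m : MeasurableSpace Ω} (n : ℕ), (∀ t < n, Measurable[m] (I t)) →
      (∀ t < n, Measurable[m] (X t)) →
      Measurable fun p : Θ × Ω => ∏ t ∈ Finset.range n, φ p.1 (I t p.2) (X t p.2) := by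
    intro m n hI hX
    refine Finset.measurable_fun_prod _ fun t ht => ?_
    have ht := Finset.mem_range.1 ht
    exact hφ'.comp (((hI t ht).comp measurable_snd).prodMk
      (measurable_fst.prodMk ((hX t ht).comp measurable_snd)))
  have hIn : ∀ n, ∀ t < n, Measurable[ℱ n] (I t) := fun n t ht =>
    (h.measurable_arm t).mono (ℱ.mono ht.le) le_rfl
  have hXn : ∀ n, ∀ t < n, Measurable[ℱ n] (X t) := fun n t ht =>
    (h.measurable_reward t).mono (ℱ.mono ht) le_rfl
  have hfull : ∀ n, Measurable fun p : Θ × Ω =>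
      ∏ t ∈ Finset.range n, φ p.1 (I t p.2) (X t p.2) := fun n =>
    hjoint n (fun t _ => (h.measurable_arm t).mono (ℱ.le _) le_rfl)
      fun t _ => (h.measurable_reward t).mono (ℱ.le _) le_rfl
  refine (measure_exists_le_of_setLIntegral_le (ℱ := ℱ) (fun n => ?_) (fun n A hA => ?_) c).trans
    (by simp)
  · exact @Measurable.lintegral_prod_left' Θ Ω _ (ℱ n) π _ _ (hjoint n (hIn n) (hXn n))
  · rw [lintegral_lintegral_swap
        (f := fun ω θ => ∏ t ∈ Finset.range (n + 1), φ θ (I t ω) (X t ω))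
        ((hfull (n + 1)).comp measurable_swap).aemeasurable,
      lintegral_lintegral_swap
        (f := fun ω θ => ∏ t ∈ Finset.range n, φ θ (I t ω) (X t ω))
        ((hfull n).comp measurable_swap).aemeasurable]
    refine lintegral_mono fun θ => ?_
    have hY : Measurable[ℱ n] fun ω => ∏ t ∈ Finset.range n, φ θ (I t ω) (X t ω) :=
      (hjoint n (hIn n) (hXn n)).comp (measurable_const.prodMk measurable_id)
    have hk : ∀ k, Measurable (φ θ k) := fun k =>
      (hφ k).comp (measurable_const.prodMk measurable_id)
    have h1 := h.lintegral_mul_le n (hY.indicator hA) hk (hφ1 θ)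
    rw [lintegral_indicator (ℱ.le n _ hA)] at h1
    rw [← lintegral_indicator (ℱ.le n _ hA)]
    refine le_trans (le_of_eq (lintegral_congr fun ω => ?_)) h1
    by_cases hω : ω ∈ A
    · simp [hω, Finset.prod_range_succ]
    · simp [hω]

end

/-! ### Evidence for a wrong order of two arms -/

lemma mean_mem_Icc {B : ℝ} {G : Measure ℝ} (hG : G ∈ boundedClass B) : mean G ∈ Set.Icc 0 B := by
  have := hG.1
  have hae : ∀ᵐ x ∂G, x ∈ Set.Icc 0 B := hG.2
  have hi : Integrable (fun x : ℝ => x) G :=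
    Integrable.of_mem_Icc 0 B aemeasurable_id hae
  constructor
  · exact integral_nonneg_of_ae (hae.mono fun x hx => hx.1)
  · have h := integral_mono_ae hi (integrable_const B) (hae.mono fun x hx => hx.2)
    simpa [mean] using h

lemma mem_meanSet_boundedClass {B x : ℝ} (hx : x ∈ Set.Icc 0 B) :
    x ∈ meanSet (boundedClass B) :=
  ⟨Measure.dirac x, ⟨inferInstance, by simp [hx.1, hx.2]⟩, by simp [mean]⟩

/-- The expected growth factor is at most `1` under a distribution that satisfies the mean
constraint encoded by the payoff. -/
lemma lintegral_betFactor_le_one {B e b θ : ℝ} (hθ : θ ∈ Set.Icc (0 : ℝ) 1) {G : Measure ℝ}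
    (hG : G ∈ boundedClass B) (hr : ∀ x ∈ Set.Icc 0 B, 0 ≤ meanBet e b x)
    (hm : meanBet e b (mean G) ≤ 1) :
    ∫⁻ x, ENNReal.ofReal (betFactor θ (meanBet e b x)) ∂G ≤ 1 := by
  have := hG.1
  have hae : ∀ᵐ x ∂G, x ∈ Set.Icc 0 B := hG.2
  have hi : Integrable (fun x : ℝ => x) G :=
    Integrable.of_mem_Icc 0 B aemeasurable_id hae
  have hi2 : Integrable (fun x => meanBet e b x) G := by
    unfold meanBet; exact ((integrable_const e).sub hi).div_const _
  have hint : ∫ x, betFactor θ (meanBet e b x) ∂G = betFactor θ (meanBet e b (mean G)) := by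
    simp only [betFactor]
    rw [integral_add (integrable_const _) (hi2.const_mul θ), integral_const_mul]
    simp only [meanBet]
    rw [integral_div, integral_sub (integrable_const _) hi]
    simp [mean]
  rw [← ofReal_integral_eq_lintegral_ofReal, hint]
  · rw [ENNReal.ofReal_le_one]
    have := mul_le_mul_of_nonneg_left hm hθ.1
    simp only [betFactor]; linarith
  · exact (integrable_const _).add (hi2.const_mul θ)
  · exact hae.mono fun x hx => betFactor_nonneg hθ (hr x hx)

/-- The contribution of one arm to the transportation cost is at most the log-wealth `log p` of
the best betting fraction in hindsight, and `p` is at most `exp 1 * (N + 1)` times the wealth of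
the uniform mixture. Here `κ` stands for either `K_inf⁺` or `K_inf⁻`. -/
lemma exists_pulls_mul_le_log {Ω : Type*} {K : ℕ} {I : ℕ → Ω → Fin K} {X : ℕ → Ω → ℝ} {ω : Ω}
    {B e b : ℝ} (he : e ∈ Set.Icc 0 B) (hr : ∀ x ∈ Set.Icc 0 B, 0 ≤ meanBet e b x)
    (hX : ∀ t, X t ω ∈ Set.Icc 0 B) (n : ℕ) (k : Fin K) {κ : ℝ≥0∞}
    (hκ : ∀ G ∈ boundedClass B, meanBet e b (mean G) ≤ 1 →
      κ ≤ klDiv (empDist I X n k ω) G) :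
    ∃ p : ℝ, 1 ≤ p ∧ (pulls I n k ω : ℝ≥0∞) * κ ≤ ENNReal.ofReal (Real.log p) ∧
      ENNReal.ofReal p ≤ ENNReal.ofReal (Real.exp 1 * (pulls I n k ω + 1)) *
        ∫⁻ η : unitInterval, ∏ t ∈ (Finset.range n).filter (fun t => I t ω = k),
          ENNReal.ofReal (betFactor η (meanBet e b (X t ω))) := by
  set T := (Finset.range n).filter (fun t => I t ω = k) with hT
  have hN : pulls I n k ω = T.card := rfl
  have hrT : ∀ t ∈ T, 0 ≤ meanBet e b (X t ω) := fun t _ => hr _ (hX t)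
  rcases T.eq_empty_or_nonempty with h0 | hne
  · refine ⟨1, le_rfl, by simp [hN, h0], ?_⟩
    have h := prod_betFactor_le_lintegral T (fun t => meanBet e b (X t ω)) hrT
      (θ := 0) (by simp)
    simpa only [h0, hN, Finset.prod_empty] using h
  · obtain ⟨θ, hθ, h1, G, hG, hm, hkl⟩ :=
      exists_klDiv_empirical_eq hne he (fun t _ => hX t) hrT
    refine ⟨_, h1, ?_, prod_betFactor_le_lintegral T (fun t => meanBet e b (X t ω)) hrT hθ⟩
    rw [← hkl, hN]
    gcongr
    exact hκ G hG hm

/-- The threshold pays for the cost of the two mixtures, since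
`(N + 1) * (M + 1) ≤ (1 + n / 2) ^ 2`, and leaves the factor `(K - 1) / δ`. -/
lemma ofReal_le_mul_of_threshold_lt {K : ℕ} (hK : 2 ≤ K) {δ : ℝ} (hδ : 0 < δ) {n N M : ℕ}
    (hn : N + M ≤ n) {p q : ℝ} (hp : 1 ≤ p) (hq : 1 ≤ q) {A A' : ℝ≥0∞}
    (hpA : ENNReal.ofReal p ≤ ENNReal.ofReal (Real.exp 1 * (N + 1)) * A)
    (hqA : ENNReal.ofReal q ≤ ENNReal.ofReal (Real.exp 1 * (M + 1)) * A')
    (hc : ENNReal.ofReal (threshold K δ n) <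
      ENNReal.ofReal (Real.log p) + ENNReal.ofReal (Real.log q)) :
    ENNReal.ofReal (((K : ℝ) - 1) / δ) ≤ A * A' := by
  have hK1 : (0 : ℝ) < (K : ℝ) - 1 := by
    have : (2 : ℝ) ≤ K := by exact_mod_cast hK
    linarith
  set D : ℝ := (Real.exp 1 * (1 + (n : ℝ) / 2)) ^ 2 with hD
  have hD0 : 0 < D := by positivity
  have hp0 : 0 < p := by linarith
  have hq0 : 0 < q := by linarith
  rw [← ENNReal.ofReal_add (Real.log_nonneg hp) (Real.log_nonneg hq), ENNReal.ofReal_lt_ofReal_iff',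
    ← Real.log_mul hp0.ne' hq0.ne'] at hc
  have hexp : Real.exp (threshold K δ n) = D * (((K : ℝ) - 1) / δ) := by
    have h1 : (0 : ℝ) < 1 + (n : ℝ) / 2 := by positivity
    have h2 : 2 * Real.log (1 + (n : ℝ) / 2) = Real.log ((1 + (n : ℝ) / 2) ^ 2) := by
      rw [Real.log_pow]; norm_num
    rw [threshold, h2, Real.exp_add, Real.exp_add, Real.exp_add, Real.exp_log (by positivity),
      Real.exp_log (by positivity), Real.exp_log hK1, hD, mul_pow, ← Real.exp_nat_mul]
    push_cast
    rw [mul_one]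
    ring
  have hlt : D * (((K : ℝ) - 1) / δ) ≤ p * q := by
    rw [← hexp, ← Real.exp_log (mul_pos hp0 hq0)]
    exact Real.exp_le_exp.2 hc.1.le
  have hNM : Real.exp 1 * (N + 1) * (Real.exp 1 * (M + 1)) ≤ D := by
    have hn' : (N : ℝ) + M ≤ n := by exact_mod_cast hn
    have h3 : ((N : ℝ) + 1) * (M + 1) ≤ (1 + (n : ℝ) / 2) ^ 2 := by
      have h4 : (((N : ℝ) + M) / 2 + 1) ^ 2 ≤ (1 + (n : ℝ) / 2) ^ 2 := by
        gcongr ?_ ^ 2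
        linarith
      nlinarith [sq_nonneg ((N : ℝ) - M)]
    calc _ = Real.exp 1 ^ 2 * (((N : ℝ) + 1) * (M + 1)) := by ring
      _ ≤ Real.exp 1 ^ 2 * (1 + (n : ℝ) / 2) ^ 2 := by gcongr
      _ = D := by rw [hD, mul_pow]
  refine (ENNReal.mul_le_mul_iff_right (a := ENNReal.ofReal D) (by simpa using hD0)
    ENNReal.ofReal_ne_top).1 ?_
  calc ENNReal.ofReal D * ENNReal.ofReal (((K : ℝ) - 1) / δ)
      = ENNReal.ofReal (D * (((K : ℝ) - 1) / δ)) := (ENNReal.ofReal_mul hD0.le).symm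
    _ ≤ ENNReal.ofReal (p * q) := ENNReal.ofReal_le_ofReal hlt
    _ = ENNReal.ofReal p * ENNReal.ofReal q := ENNReal.ofReal_mul hp0.le
    _ ≤ (ENNReal.ofReal (Real.exp 1 * (N + 1)) * A) *
        (ENNReal.ofReal (Real.exp 1 * (M + 1)) * A') := mul_le_mul' hpA hqA
    _ = ENNReal.ofReal (Real.exp 1 * (N + 1) * (Real.exp 1 * (M + 1))) * (A * A') := by
      rw [ENNReal.ofReal_mul (p := Real.exp 1 * (N + 1)) (by positivity)]; ring
    _ ≤ _ := by gcongr

lemma pulls_add_pulls_le {Ω : Type*} {K : ℕ} (I : ℕ → Ω → Fin K) (n : ℕ) {i j : Fin K}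
    (hij : i ≠ j) (ω : Ω) : pulls I n i ω + pulls I n j ω ≤ n := by
  rw [pulls, pulls, ← Finset.card_union_of_disjoint]
  · refine (Finset.card_le_card (Finset.union_subset (Finset.filter_subset _ _)
      (Finset.filter_subset _ _))).trans (by simp)
  · exact Finset.disjoint_filter.2 fun t _ h1 h2 => hij (h1.symm.trans h2)

/-- If arm `i` is worse than arm `j`, the evidence for the opposite order passes the threshold with
probability at most `δ / (K - 1)`: for a level `x` between the two means, bet on the rewards of arm
`i` against a mean below `x` and on those of arm `j` against a mean above `x`. -/
lemma measure_transportCost_gt_le {K : ℕ} (hK : 2 ≤ K) {B δ : ℝ} (hδ : 0 < δ)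
    {F : Fin K → Measure ℝ} (hF : ∀ i, F i ∈ boundedClass B)
    {Ω : Type*} [mΩ : MeasurableSpace Ω] {P : Measure Ω} [IsProbabilityMeasure P]
    {ℱ : Filtration ℕ mΩ} {I : ℕ → Ω → Fin K} {X : ℕ → Ω → ℝ} (hIX : IsInteraction F P ℱ I X)
    {i j : Fin K} (hij : mean (F i) < mean (F j)) :
    P {ω | ∃ n, ENNReal.ofReal (threshold K δ n) < transportCost I X (boundedClass B) n i j ω} ≤
      ENNReal.ofReal (δ / ((K : ℝ) - 1)) := by
  have hne : i ≠ j := fun h => by simp [h] at hij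
  have hFp : ∀ k, IsProbabilityMeasure (F k) := fun k => (hF k).1
  have hK1 : (0 : ℝ) < (K : ℝ) - 1 := by
    have : (2 : ℝ) ≤ K := by exact_mod_cast hK
    linarith
  obtain ⟨x, hix, hxj⟩ := exists_between hij
  -- The bets use levels strictly on either side of `x`, so that the dual optima satisfy the
  -- strict inequalities in `K_inf`.
  obtain ⟨a, hia, hax⟩ := exists_between hix
  obtain ⟨b, hxb, hbj⟩ := exists_between hxj
  have ha : 0 < a := (mean_mem_Icc (hF i)).1.trans_lt hia
  have hb : b < B := hbj.trans_le (mean_mem_Icc (hF j)).2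
  have hb' : 0 < B - b := sub_pos.2 hb
  have hB : 0 ≤ B := by linarith
  have hbet0 : ∀ y, meanBet 0 a y = y / a := fun y => by simp [meanBet, neg_div_neg_eq]
  have hr0 : ∀ y ∈ Set.Icc 0 B, 0 ≤ meanBet 0 a y := fun y hy => by
    rw [hbet0]; exact div_nonneg hy.1 ha.le
  have hrB : ∀ y ∈ Set.Icc 0 B, 0 ≤ meanBet B b y := fun y hy =>
    div_nonneg (sub_nonneg.2 hy.2) hb'.le
  have hle0 : ∀ y, meanBet 0 a y ≤ 1 ↔ y ≤ a := fun y => by rw [hbet0, div_le_one ha]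
  have hleB : ∀ y, meanBet B b y ≤ 1 ↔ b ≤ y := fun y => by
    rw [meanBet, div_le_one hb']; exact sub_le_sub_iff_left B
  let φ : unitInterval × unitInterval → Fin K → ℝ → ℝ≥0∞ := fun θ k y =>
    (if k = i then ENNReal.ofReal (betFactor θ.1 (meanBet 0 a y)) else 1) *
      (if k = j then ENNReal.ofReal (betFactor θ.2 (meanBet B b y)) else 1)
  have hφ : ∀ k, Measurable fun p : (unitInterval × unitInterval) × ℝ => φ p.1 k p.2 := by
    intro k
    have h1 : Measurable fun p : (unitInterval × unitInterval) × ℝ =>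
        ENNReal.ofReal (betFactor p.1.1 (meanBet 0 a p.2)) := by
      unfold betFactor meanBet; fun_prop
    have h2 : Measurable fun p : (unitInterval × unitInterval) × ℝ =>
        ENNReal.ofReal (betFactor p.1.2 (meanBet B b p.2)) := by
      unfold betFactor meanBet; fun_prop
    refine Measurable.mul ?_ ?_
    · by_cases h : k = i
      · simpa [h] using h1
      · simp [h]
    · by_cases h : k = j
      · simpa [h] using h2
      · simp [h]
  have hφ1 : ∀ θ k, ∫⁻ y, φ θ k y ∂(F k) ≤ 1 := by
    intro θ k
    by_cases hki : k = i
    · subst hki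
      simpa [φ, hne] using lintegral_betFactor_le_one θ.1.2 (hF k) hr0 ((hle0 _).2 hia.le)
    · by_cases hkj : k = j
      · subst hkj
        simpa [φ, hki] using lintegral_betFactor_le_one θ.2.2 (hF k) hrB ((hleB _).2 hbj.le)
      · simp [φ, hki, hkj]
  have hville := hIX.measure_mixture_ge_le
    ((volume : Measure unitInterval).prod (volume : Measure unitInterval)) hφ hφ1
    (ENNReal.ofReal (((K : ℝ) - 1) / δ))
  have hsplit : ∀ n ω, ∫⁻ θ, ∏ t ∈ Finset.range n, φ θ (I t ω) (X t ω)
      ∂((volume : Measure unitInterval).prod (volume : Measure unitInterval)) =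
      (∫⁻ η : unitInterval, ∏ t ∈ (Finset.range n).filter (fun t => I t ω = i),
          ENNReal.ofReal (betFactor η (meanBet 0 a (X t ω)))) *
        ∫⁻ η : unitInterval, ∏ t ∈ (Finset.range n).filter (fun t => I t ω = j),
          ENNReal.ofReal (betFactor η (meanBet B b (X t ω))) := by
    intro n ω
    rw [← lintegral_prod_mul]
    · refine lintegral_congr fun θ => ?_
      simp only [φ]
      rw [Finset.prod_mul_distrib, Finset.prod_filter, Finset.prod_filter]
    · refine Measurable.aemeasurable (Finset.measurable_fun_prod _ fun t _ => ?_)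
      unfold betFactor; fun_prop
    · refine Measurable.aemeasurable (Finset.measurable_fun_prod _ fun t _ => ?_)
      unfold betFactor; fun_prop
  have hsub : {ω | ∃ n, ENNReal.ofReal (threshold K δ n) <
      transportCost I X (boundedClass B) n i j ω} ≤ᵐ[P]
      {ω | ∃ n, ENNReal.ofReal (((K : ℝ) - 1) / δ) ≤
        ∫⁻ θ, ∏ t ∈ Finset.range n, φ θ (I t ω) (X t ω)
          ∂((volume : Measure unitInterval).prod (volume : Measure unitInterval))} := by
    filter_upwards [hIX.ae_mem measurableSet_Icc fun k => (hF k).2] with ω hω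
    rintro ⟨n, hn⟩
    refine ⟨n, ?_⟩
    rw [hsplit]
    obtain ⟨p, hp1, hp, hpA⟩ := exists_pulls_mul_le_log (I := I) ⟨le_rfl, hB⟩ hr0 hω n i
      (κ := kinfMinus (boundedClass B) (empDist I X n i ω) x) fun G hG hm =>
        iInf₂_le G ⟨hG, ((hle0 _).1 hm).trans_lt hax⟩
    obtain ⟨q, hq1, hq, hqA⟩ := exists_pulls_mul_le_log (I := I) ⟨hB, le_rfl⟩ hrB hω n j
      (κ := kinfPlus (boundedClass B) (empDist I X n j ω) x) fun G hG hm =>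
        iInf₂_le G ⟨hG, hxb.trans_le ((hleB _).1 hm)⟩
    refine ofReal_le_mul_of_threshold_lt hK hδ (pulls_add_pulls_le I n hne ω) hp1 hq1 hpA hqA ?_
    refine hn.trans_le (le_trans ?_ (add_le_add hp hq))
    exact iInf₂_le x (mem_meanSet_boundedClass ⟨by linarith, by linarith⟩)
  refine (measure_mono_ae hsub).trans ?_
  rw [← inv_div ((K : ℝ) - 1) δ, ENNReal.ofReal_inv_of_pos (by positivity),
    ENNReal.le_inv_iff_mul_le, mul_comm]
  exact hville

/-- A finite stopping time satisfies the stopping criterion. -/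
lemma threshold_lt_of_stoppingTime_lt_top {Ω : Type*} {K : ℕ} {I : ℕ → Ω → Fin K}
    {X : ℕ → Ω → ℝ} {𝓕 : Set (Measure ℝ)} {ihat : ℕ → Ω → Fin K} {c : ℕ → ℝ} {ω : Ω}
    (h : stoppingTime I X 𝓕 ihat c ω < ⊤) {j : Fin K}
    (hj : j ≠ ihat (stoppingTime I X 𝓕 ihat c ω).toNat ω) :
    ENNReal.ofReal (c (stoppingTime I X 𝓕 ihat c ω).toNat) <
      transportCost I X 𝓕 (stoppingTime I X 𝓕 ihat c ω).toNat
        (ihat (stoppingTime I X 𝓕 ihat c ω).toNat ω) j ω := by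
  set S : Set ℕ := {n : ℕ | ENNReal.ofReal (c n) <
    ⨅ (j : Fin K) (_ : j ≠ ihat n ω), transportCost I X 𝓕 n (ihat n ω) j ω} with hS
  have hτ : stoppingTime I X 𝓕 ihat c ω = sInf ((fun n : ℕ => (n : ℕ∞)) '' S) := sInf_image.symm
  have hne : ((fun n : ℕ => (n : ℕ∞)) '' S).Nonempty := by
    by_contra! h0
    rw [hτ, h0, sInf_empty] at h
    exact lt_irrefl _ h
  obtain ⟨n, hn, hnτ⟩ := csInf_mem hne
  rw [← hτ] at hnτ
  rw [← hnτ, ENat.toNat_natCast] at hj ⊢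
  exact lt_of_lt_of_le hn (iInf₂_le j hj)

theorem lemma2 {K : ℕ} (hK : 2 ≤ K) {B : ℝ} (hB : 0 < B) {δ : ℝ} (hδ : 0 < δ) (hδ1 : δ < 1)
    (F : Fin K → Measure ℝ) (hF : ∀ i, F i ∈ Bandit.boundedClass B)
    {Ω : Type*} [mΩ : MeasurableSpace Ω] (P : Measure Ω) [IsProbabilityMeasure P]
    (ℱ : Filtration ℕ mΩ) (I : ℕ → Ω → Fin K) (X : ℕ → Ω → ℝ)
    (hIX : Bandit.IsInteraction F P ℱ I X)
    (ihat : ℕ → Ω → Fin K) (hihat : Bandit.IsEmpiricalBest I X ihat)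
    (τ : Ω → ℕ∞)
    (hτ : τ = Bandit.stoppingTime I X (Bandit.boundedClass B) ihat (Bandit.threshold K δ)) :
    P {ω | τ ω < ⊤ ∧ ihat (τ ω).toNat ω ∉ Bandit.bestArms F} ≤ ENNReal.ofReal δ := by
  have hK1 : (0 : ℝ) < (K : ℝ) - 1 := by
    have : (2 : ℝ) ≤ K := by exact_mod_cast hK
    linarith
  have : Nonempty (Fin K) := ⟨⟨0, by omega⟩⟩
  obtain ⟨j, hj⟩ := Finite.exists_max fun k => Bandit.mean (F k)
  set S : Finset (Fin K) :=
    Finset.univ.filter fun i => Bandit.mean (F i) < Bandit.mean (F j) with hS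
  have hcard : (S.card : ℝ) ≤ (K : ℝ) - 1 := by
    have h1 : S.card < K := by
      have := Finset.card_lt_card (Finset.filter_ssubset.2
        ⟨j, Finset.mem_univ j, lt_irrefl (Bandit.mean (F j))⟩ : S ⊂ Finset.univ)
      simpa using this
    have h2 : (S.card : ℝ) + 1 ≤ K := by exact_mod_cast h1
    linarith
  calc P {ω | τ ω < ⊤ ∧ ihat (τ ω).toNat ω ∉ Bandit.bestArms F}
      ≤ P (⋃ i ∈ S, {ω | ∃ n, ENNReal.ofReal (Bandit.threshold K δ n) <
          Bandit.transportCost I X (Bandit.boundedClass B) n i j ω}) := by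
        refine measure_mono fun ω hω => ?_
        obtain ⟨hfin, hbad⟩ := hω
        rw [hτ] at hfin hbad
        simp only [Set.mem_iUnion]
        have hlt : Bandit.mean (F (ihat (Bandit.stoppingTime I X (Bandit.boundedClass B) ihat
            (Bandit.threshold K δ) ω).toNat ω)) < Bandit.mean (F j) := by
          by_contra! hge
          exact hbad fun k => (hj k).trans hge
        refine ⟨_, Finset.mem_filter.2 ⟨Finset.mem_univ _, hlt⟩, _,
          threshold_lt_of_stoppingTime_lt_top hfin fun h => ?_⟩
        rw [← h] at hlt
        exact lt_irrefl _ hlt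
    _ ≤ ∑ i ∈ S, P {ω | ∃ n, ENNReal.ofReal (Bandit.threshold K δ n) <
          Bandit.transportCost I X (Bandit.boundedClass B) n i j ω} :=
        measure_biUnion_finset_le _ _
    _ ≤ ∑ _i ∈ S, ENNReal.ofReal (δ / ((K : ℝ) - 1)) :=
        Finset.sum_le_sum fun i hi =>
          measure_transportCost_gt_le hK hδ hF hIX (Finset.mem_filter.1 hi).2
    _ = ENNReal.ofReal (S.card * (δ / ((K : ℝ) - 1))) := by
        rw [Finset.sum_const, nsmul_eq_mul, ENNReal.ofReal_mul (Nat.cast_nonneg _),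
          ENNReal.ofReal_natCast]
    _ ≤ ENNReal.ofReal δ := by
        refine ENNReal.ofReal_le_ofReal ?_
        rw [← mul_div_assoc, div_le_iff₀ hK1, mul_comm]
        exact mul_le_mul_of_nonneg_left hcard hδ.le
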